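/- Notation. For $\tau\in\mathbb Z^d$ let $|\tau|=\max_j|\tau_j|$. A filter is a function $q:\mathbb Z^d\to\mathbb C$ with finitely many nonzero values; it has order at most $T$ if $q_\tau=0$ whenever $|\tau|>T$; $|q|_2=(\sum_\tau|q_\tau|^2)^{1/2}$, and $(q(\Delta)s)_t=\sum_\tau q_\tau s_{t-\tau}$ for a field $s:\mathbb Z^d\to\mathbb C$. Let $\theta\ge 0$, $\rho\ge 1$, $t\in\mathbb Z^d$, and let $L\ge 0$ be an integer. A random complex field $(s_\tau)_{\tau\in\mathbb Z^d}$ is well-filtered at $t$ with parameters $\theta,\rho,L$, written $(s_\tau)\in\mathbf F^t_L(\theta,\rho)$, if for every integer $T$ with $0\le T\le L$ there is a (deterministic) filter $q^{(T)}$ of order at most $T$ with $$|q^{(T)}|_2\le\frac{\rho}{(2T+1)^{d/2}}\quad\text{and}\quad \max_{\tau:\,|\tau-t|\le L}\left(E\left|s_\tau-(q^{(T)}(\Delta)s)_\tau\right|^2\right)^{1/2}\le\theta(2T+1)^{-d/2};$$ the filters $q^{(T)}$ are said to certify this inclusion. For a positive integer $M$ let $D_{2M}=\{x\in\mathbb R^d:|x_j|\le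 2M,\ j\le d\}$, and for a real $R>0$ let $\mathbf H(M,R)$ be the family of restrictions to $\mathbb Z^d$ of random functions $f:\mathbb R^d\to\mathbb C$, on any probability space, such that every realization of $f$ is continuous on $\mathbb R^d$ and harmonic in the interior of $D_{2M}$, and $E\{\sup_{x\in D_{2M}}|f(x)|^2\}\le R^2$. Proposition. There are an absolute constant $c\in(0,1]$ and filters $q^{(d,T)}$ on $\mathbb Z^d$, depending only on $d$ and $T$, such that the following holds for all $d\le 4$, all positive integers $M$, all reals $R>0$, all random fields $(s_\tau)\in\mathbf H(M,R)$, all $t\in\mathbb Z^d$ and all integers $L\ge 0$: if $|t|\le cM$ and $L\le cM$, then $$(s_\tau)\in\mathbf F^t_L(c^{-1}R,\,c^{-1}),$$ and this inclusion is certified by the filters $q^{(d,T)}$, $0\le T\le L$. -/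

import Mathlib

open MeasureTheory
open scoped ENNReal

namespace HarmFilt

/-- The lattice `ℤ^d`. -/
abbrev Lattice (d : ℕ) : Type := Fin d → ℤ

/-- `|τ| = max_j |τ_j|` (and `0` when `d = 0`). -/
def latticeNorm {d : ℕ} (τ : Lattice d) : ℕ :=
  Finset.univ.sup fun j => (τ j).natAbs

/-- A filter on `ℤ^d`: a complex-valued field on `ℤ^d` with finitely many nonzero entries. -/
abbrev LatticeFilter (d : ℕ) : Type := Lattice d →₀ ℂ

/-- `q ∈ C_T(ℤ^d)`: the filter `q` has order at most `T`. -/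
def OrderLE {d : ℕ} (q : LatticeFilter d) (T : ℕ) : Prop :=
  ∀ τ : Lattice d, T < latticeNorm τ → q τ = 0

/-- The norm `|q|_2`. -/
noncomputable def l2norm {d : ℕ} (q : LatticeFilter d) : ℝ :=
  Real.sqrt (q.sum fun _ a => ‖a‖ ^ 2)

/-- The output of the filter `q` on the input field `x`:
`(q(Δ)x)_t = ∑_τ q_τ x_{t-τ}`. -/
noncomputable def applyFilter {d : ℕ} (q : LatticeFilter d) (x : Lattice d → ℂ) :
    Lattice d → ℂ :=
  fun t => q.sum fun τ a => a * x (t - τ)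

/-- The filter `q` certifies that the random field `s` is `T`-well-filtered at `t` with parameters
`θ, ρ, L`: it has order at most `T`, satisfies `|q|_2 ≤ ρ (2T+1)^{-d/2}`, and for every `τ` in the
box `|τ - t| ≤ L` the mean square error `(E |s_τ - (q(Δ)s)_τ|²)^{1/2}` (the `L²`-norm `eLpNorm`,
with values in `[0,∞]`) is at most `θ (2T+1)^{-d/2}`. -/
def Certifies {d : ℕ} {Ω : Type*} [MeasurableSpace Ω] (P : Measure Ω) (q : LatticeFilter d)
    (s : Ω → Lattice d → ℂ) (t : Lattice d) (L : ℕ∞) (θ ρ : ℝ) (T : ℕ) : Prop :=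
  OrderLE q T ∧
  l2norm q ≤ ρ / (2 * (T : ℝ) + 1) ^ ((d : ℝ) / 2) ∧
  ∀ τ : Lattice d, (latticeNorm (τ - t) : ℕ∞) ≤ L →
    eLpNorm (fun ω => s ω τ - applyFilter q (s ω) τ) 2 P ≤
      ENNReal.ofReal (θ * (2 * (T : ℝ) + 1) ^ (-((d : ℝ) / 2)))

/-- `s ∈ S^t_L(θ, ρ, T)`: the random field `s` is `T`-well-filtered at `t`. -/
def TWellFiltered {d : ℕ} {Ω : Type*} [MeasurableSpace Ω] (P : Measure Ω)
    (s : Ω → Lattice d → ℂ) (t : Lattice d) (L : ℕ∞) (θ ρ : ℝ) (T : ℕ) : Prop :=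
  ∃ q : LatticeFilter d, Certifies P q s t L θ ρ T

/-- `s ∈ F^t_L(θ, ρ)`: the random field `s` is well-filtered at `t`. -/
def WellFiltered {d : ℕ} {Ω : Type*} [MeasurableSpace Ω] (P : Measure Ω)
    (s : Ω → Lattice d → ℂ) (t : Lattice d) (L : ℕ∞) (θ ρ : ℝ) : Prop :=
  ∀ T : ℕ, (T : ℕ∞) ≤ L → TWellFiltered P s t L θ ρ T

/-- The box `{x ∈ ℝ^d : |x_j| ≤ 2M for all j}`. -/
def box (d M : ℕ) : Set (EuclideanSpace ℝ (Fin d)) :=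
  {x | ∀ j, |x j| ≤ 2 * (M : ℝ)}

/-- Continuous functions on `ℝ^d` that are harmonic in the interior of the box. -/
def harmonicFunctions (d M : ℕ) : Set (EuclideanSpace ℝ (Fin d) → ℂ) :=
  {f | Continuous f ∧ InnerProductSpace.HarmonicOnNhd f (interior (box d M))}

/-- The uniform norm on the box, with values in `[0,∞]`. -/
noncomputable def boxNorm {d : ℕ} (M : ℕ) (f : EuclideanSpace ℝ (Fin d) → ℂ) : ℝ≥0∞ :=
  ⨆ x ∈ box d M, ‖f x‖ₑ

/-- Random functions on the probability space `(Ω, P)` all of whose realizations are continuous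
and harmonic in the interior of the box, and for which `E ‖f‖² ≤ R²`, where `‖·‖` is the uniform
norm on the box. -/
def randomHarmonicFunctions (d M : ℕ) (R : ℝ) {Ω : Type*} [MeasurableSpace Ω] (P : Measure Ω) :
    Set (Ω → EuclideanSpace ℝ (Fin d) → ℂ) :=
  {f | (∀ x, Measurable fun ω => f ω x) ∧
    (∀ ω, f ω ∈ harmonicFunctions d M) ∧
    ∫⁻ ω, boxNorm M (f ω) ^ 2 ∂P ≤ ENNReal.ofReal (R ^ 2)}

/-- The point of `ℝ^d` given by a lattice point. -/
noncomputable def latticePoint {d : ℕ} (τ : Lattice d) : EuclideanSpace ℝ (Fin d) :=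
  WithLp.toLp 2 fun j => (τ j : ℝ)

/-- The random fields on `ℤ^d` that are restrictions of the random functions above. -/
def randomHarmonicFields (d M : ℕ) (R : ℝ) {Ω : Type*} [MeasurableSpace Ω] (P : Measure Ω) :
    Set (Ω → Lattice d → ℂ) :=
  {s | ∃ f ∈ randomHarmonicFunctions d M R P, s = fun ω τ => f ω (latticePoint τ)}

end HarmFilt

/-! The filter samples a smooth averaging kernel, and the error is that of a midpoint rule. Let `k`
be a radial C² bump on the unit ball of integral one, `h = 2/(T+1)`, and let the filter have weights
`h^d k(h n)`, `|n| ≤ T`. There are about `h^{-d}` weights of size `O(h^d)`, which gives the ℓ²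
bound.

For the error at `x`, put `F(w) = f(x - w/h)`. The mean value property `integral_meanKernel_smul`
says that averaging `F` against a translate of `k` returns `F` at the centre. Used twice, it gives
`f(x) = ∫ (k*k) F`. Used once on each sample, it turns the filter output into `∫ J F`, where `J(w) =
∑ h^d k(hn) k(w - hn)` is the midpoint sum for `(k*k)(w)`. All smoothness needed is now carried by
`k`, and only a sup bound on `f` enters. Midpoint sums are second order accurate, so `|k*k - J| =
O(h²)` uniformly in `w` (`exists_meanKernel_quadrature_bound`), and the error is `O(h²) sup |f|`
over a ball of radius `T+1` (`exists_norm_sub_meanFilter_le`).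

Finally `h² = O((2T+1)^{-2})`, which is at most the required order `(2T+1)^{-d/2}` exactly because
`d ≤ 4`. The bound is pathwise and linear in the sup norm, so it passes to mean squares. -/

namespace HarmFilt

open Metric Filter Topology InnerProductSpace Laplacian

/-! ### Mean value property for a smooth radial weight. -/

section MeanValue

variable {E : Type*} [NormedAddCommGroup E]

/-- A smooth function of one variable, positive on `u < 1` and zero on `1 ≤ u`. -/
noncomputable def radialProfile (u : ℝ) : ℝ := expNegInvGlue (1 - u)

/-- The primitive of `radialProfile` that vanishes on `1 ≤ u`. -/
noncomputable def radialPrimitive (u : ℝ) : ℝ := ∫ v in (1 : ℝ)..u, radialProfile v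

lemma contDiff_radialProfile : ContDiff ℝ 2 radialProfile :=
  (expNegInvGlue.contDiff (n := 2)).comp (contDiff_const.sub contDiff_id)

lemma radialProfile_eq_zero {u : ℝ} (hu : 1 ≤ u) : radialProfile u = 0 :=
  expNegInvGlue.zero_of_nonpos (by linarith)

lemma hasDerivAt_radialPrimitive (u : ℝ) :
    HasDerivAt radialPrimitive (radialProfile u) u :=
  (contDiff_radialProfile.continuous.integral_hasStrictDerivAt 1 u).hasDerivAt

lemma radialPrimitive_eq_zero {u : ℝ} (hu : 1 ≤ u) : radialPrimitive u = 0 := by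
  rw [radialPrimitive, intervalIntegral.integral_congr (g := fun _ => (0 : ℝ))]
  · simp
  · intro v hv
    rw [Set.uIcc_of_le hu] at hv
    exact radialProfile_eq_zero hv.1

/-- A smooth radial bump supported in the unit ball. -/
noncomputable def radialBump (y : E) : ℝ := radialProfile (‖y‖ ^ 2)

lemma radialBump_eq_zero {y : E} (hy : 1 ≤ ‖y‖) : radialBump y = 0 :=
  radialProfile_eq_zero (one_le_pow₀ hy)

variable [InnerProductSpace ℝ E]

lemma contDiff_radialBump : ContDiff ℝ 2 (radialBump : E → ℝ) :=
  contDiff_radialProfile.comp (contDiff_norm_sq ℝ)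

lemma hasFDerivAt_radialPrimitive_norm_sq (y : E) :
    HasFDerivAt (fun y : E => radialPrimitive (‖y‖ ^ 2))
      ((2 * radialBump y) • innerSL ℝ y) y := by
  have h := (hasDerivAt_radialPrimitive (‖y‖ ^ 2)).comp_hasFDerivAt y
    (HasStrictFDerivAt.hasFDerivAt (hasStrictFDerivAt_norm_sq y))
  refine h.congr_fderiv ?_
  rw [mul_comm, mul_smul]
  congr 1
  simp [two_smul]

variable [FiniteDimensional ℝ E]

lemma hasCompactSupport_of_eq_zero {F : Type*} [Zero F] {u : E → F} (r : ℝ)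
    (hu : ∀ y, r ≤ ‖y‖ → u y = 0) : HasCompactSupport u :=
  HasCompactSupport.intro (isCompact_closedBall 0 r) fun y hy => hu y <| by
    rw [mem_closedBall_zero_iff, not_le] at hy
    exact hy.le

variable [MeasurableSpace E] [BorelSpace E]

lemma integral_radialBump_pos : 0 < ∫ y : E, radialBump y := by
  refine Continuous.integral_pos_of_hasCompactSupport_nonneg_nonzero (x := 0)
    contDiff_radialBump.continuous
    (hasCompactSupport_of_eq_zero 1 fun y hy => radialBump_eq_zero hy)
    (fun y => expNegInvGlue.nonneg _) ?_
  simp [radialBump, radialProfile]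

/-- The field `radialBump y • y` is half the gradient of `H y = radialPrimitive (‖y‖ ^ 2)`, which
vanishes outside the unit ball. Integrating by parts turns the integral into a multiple of `∫ H y •
Δ g (x + r • y)`, and the Laplacian vanishes wherever `H` does not. -/
lemma integral_radialBump_smul_fderiv_eq_zero {g : E → ℂ} (hg : ContDiff ℝ 2 g) {x : E} {r : ℝ}
    (hΔ : ∀ z ∈ closedBall x |r|, Δ g z = 0) :
    ∫ y : E, radialBump y • fderiv ℝ g (x + r • y) y = 0 := by
  set H : E → ℝ := fun y => radialPrimitive (‖y‖ ^ 2) with hH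
  have hHd : ∀ y, HasFDerivAt H ((2 * radialBump y) • innerSL ℝ y) y :=
    hasFDerivAt_radialPrimitive_norm_sq
  have hHc : Continuous H := continuous_iff_continuousAt.2 fun y => (hHd y).continuousAt
  have hH0 : ∀ y : E, 1 ≤ ‖y‖ → H y = 0 := fun y hy => radialPrimitive_eq_zero (one_le_pow₀ hy)
  have hHs : HasCompactSupport H := hasCompactSupport_of_eq_zero 1 hH0
  have hbs : HasCompactSupport (radialBump : E → ℝ) :=
    hasCompactSupport_of_eq_zero 1 fun y hy => radialBump_eq_zero hy
  have hbc : Continuous (radialBump : E → ℝ) := contDiff_radialBump.continuous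
  let b := stdOrthonormalBasis ℝ E
  have hg1 : ContDiff ℝ 1 (fderiv ℝ g) := hg.fderiv_right (by norm_num)
  have hu : ∀ i, ContDiff ℝ 1 fun y => fderiv ℝ g (x + r • y) (b i) := fun i => by
    have : ContDiff ℝ 1 fun y : E => x + r • y := by fun_prop
    exact (hg1.comp this).clm_apply contDiff_const
  have hud : ∀ i y, fderiv ℝ (fun y => fderiv ℝ g (x + r • y) (b i)) y (b i)
      = r • iteratedFDeriv ℝ 2 g (x + r • y) ![b i, b i] := by
    intro i y
    have h1 : HasFDerivAt (fun y : E => x + r • y) (r • ContinuousLinearMap.id ℝ E) y :=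
      ((hasFDerivAt_id y).const_smul r).const_add x
    have h2 := ((hg1.differentiable one_ne_zero (x + r • y)).hasFDerivAt.comp y h1).clm_apply
      (hasFDerivAt_const (b i) y)
    rw [show (fun y => fderiv ℝ g (x + r • y) (b i)) =
      fun y => (fderiv ℝ g ∘ fun y : E => x + r • y) y (b i) from rfl, h2.fderiv]
    simp [iteratedFDeriv_two_apply]
  have hparts : ∀ i, ∫ y, H y • fderiv ℝ (fun y => fderiv ℝ g (x + r • y) (b i)) y (b i) =
      - ∫ y, fderiv ℝ H y (b i) • fderiv ℝ g (x + r • y) (b i) := by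
    intro i
    have huc := (hu i).continuous
    have hudc := ((hu i).continuous_fderiv one_ne_zero).clm_apply
      (continuous_const (y := b i))
    refine integral_smul_fderiv_eq_neg_fderiv_smul_of_integrable ?_ ?_ ?_
      (fun y _ => (hHd y).differentiableAt)
      (fun y _ => (hu i).differentiable one_ne_zero y)
    · have : (fun y => fderiv ℝ H y (b i) • fderiv ℝ g (x + r • y) (b i)) =
          fun y => radialBump y • ((2 * inner ℝ y (b i)) • fderiv ℝ g (x + r • y) (b i)) := by
        ext y
        rw [(hHd y).fderiv]
        simp
        ring
      rw [this]
      refine Continuous.integrable_of_hasCompactSupport ?_ hbs.smul_right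
      fun_prop
    · exact (hHc.smul hudc).integrable_of_hasCompactSupport hHs.smul_right
    · exact (hHc.smul huc).integrable_of_hasCompactSupport hHs.smul_right
  have hsum : ∑ i, ∫ y, H y • fderiv ℝ (fun y => fderiv ℝ g (x + r • y) (b i)) y (b i) = 0 := by
    rw [← integral_finsetSum]
    · rw [← integral_zero E ℂ]
      congr 1
      ext1 y
      simp_rw [hud, ← Finset.smul_sum]
      by_cases hy : 1 ≤ ‖y‖
      · rw [hH0 y hy, zero_smul]
      · have hz : x + r • y ∈ closedBall x |r| := by
          rw [mem_closedBall, dist_self_add_left, norm_smul, Real.norm_eq_abs]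
          exact mul_le_of_le_one_right (abs_nonneg r) (not_le.1 hy).le
        have := hΔ _ hz
        rw [laplacian_eq_iteratedFDeriv_orthonormalBasis g b] at this
        simp only at this
        rw [this, smul_zero, smul_zero]
    · intro i _
      have hudc := ((hu i).continuous_fderiv one_ne_zero).clm_apply
        (continuous_const (y := b i))
      exact (hHc.smul hudc).integrable_of_hasCompactSupport hHs.smul_right
  have hsum' : ∑ i, ∫ y, fderiv ℝ H y (b i) • fderiv ℝ g (x + r • y) (b i) = 0 := by
    simp_rw [hparts, Finset.sum_neg_distrib, neg_eq_zero] at hsum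
    exact hsum
  have hexp : ∀ y : E, fderiv ℝ g (x + r • y) y =
      ∑ i, (inner ℝ y (b i) : ℝ) • fderiv ℝ g (x + r • y) (b i) := by
    intro y
    conv_lhs => rw [← b.sum_repr y, map_sum]
    refine Finset.sum_congr rfl fun i _ => ?_
    rw [map_smul, b.repr_apply_apply, real_inner_comm]
    congr 3
    rw [b.sum_repr y]
  have hcont : Continuous (fderiv ℝ g) := hg1.continuous
  simp_rw [hexp, Finset.smul_sum]
  rw [integral_finsetSum]
  · have h2 : (2 : ℝ) • ∑ i, ∫ y, radialBump y •
        ((inner ℝ y (b i) : ℝ) • fderiv ℝ g (x + r • y) (b i)) = 0 := by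
      rw [← hsum', Finset.smul_sum]
      refine Finset.sum_congr rfl fun i _ => ?_
      rw [← integral_smul]
      congr 1
      ext1 y
      rw [(hHd y).fderiv]
      simp
      ring
    exact (smul_eq_zero.1 h2).resolve_left two_ne_zero
  · intro i _
    refine Continuous.integrable_of_hasCompactSupport ?_ hbs.smul_right
    fun_prop

/-- Replace `S` by `r * S` and let `r` run from 0 to 1: the derivative in `r` is the integral shown
above to vanish, so the weighted mean equals its value at `r = 0`. Compact support of `g` bounds its
derivative, which justifies differentiating under the integral. -/
lemma integral_radialBump_smul_of_contDiff {g : E → ℂ} (hg : ContDiff ℝ 2 g)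
    (hgs : HasCompactSupport g) {x : E} {S : ℝ} (hΔ : ∀ z ∈ closedBall x |S|, Δ g z = 0) :
    ∫ y : E, radialBump y • g (x + S • y) = (∫ y : E, radialBump y) • g x := by
  have hbs : HasCompactSupport (radialBump : E → ℝ) :=
    hasCompactSupport_of_eq_zero 1 fun y hy => radialBump_eq_zero hy
  have hbc : Continuous (radialBump : E → ℝ) := contDiff_radialBump.continuous
  have hg' : Continuous (fderiv ℝ g) := hg.continuous_fderiv two_ne_zero
  have hgc := hg.continuous
  obtain ⟨C, hC⟩ := (hgs.fderiv ℝ).exists_bound_of_continuous hg'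
  have hder : ∀ r : ℝ, HasDerivAt (fun r : ℝ => ∫ y : E, radialBump y • g (x + (r * S) • y))
      (∫ y : E, radialBump y • fderiv ℝ g (x + (r * S) • y) (S • y)) r := by
    intro r
    refine (hasDerivAt_integral_of_dominated_loc_of_deriv_le (μ := volume) (s := Set.univ)
      (F := fun (r : ℝ) (y : E) => radialBump y • g (x + (r * S) • y))
      (F' := fun (r : ℝ) (y : E) => radialBump y • fderiv ℝ g (x + (r * S) • y) (S • y))
      (bound := fun y : E => ‖radialBump y‖ * (C * ‖S • y‖)) univ_mem ?_ ?_ ?_ ?_ ?_ ?_).2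
    · refine Eventually.of_forall fun r => Continuous.aestronglyMeasurable ?_
      fun_prop
    · refine Continuous.integrable_of_hasCompactSupport ?_ hbs.smul_right
      fun_prop
    · refine Continuous.aestronglyMeasurable ?_
      fun_prop
    · refine Eventually.of_forall fun y r _ => ?_
      rw [norm_smul]
      gcongr
      exact (ContinuousLinearMap.le_opNorm _ _).trans (by gcongr; exact hC _)
    · refine Continuous.integrable_of_hasCompactSupport ?_ hbs.norm.mul_right
      fun_prop
    · refine Eventually.of_forall fun y r _ => ?_
      have h1 : HasDerivAt (fun r : ℝ => x + (r * S) • y) (S • y) r := by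
        simpa using (((hasDerivAt_id r).mul_const S).smul_const y).const_add x
      have h2 := (hg.differentiable two_ne_zero (x + (r * S) • y)).hasFDerivAt.comp_hasDerivAt r h1
      exact h2.const_smul (radialBump y)
  have hzero : ∀ r ∈ Set.Icc (0 : ℝ) 1,
      ∫ y : E, radialBump y • fderiv ℝ g (x + (r * S) • y) (S • y) = 0 := by
    intro r hr
    have hS : ∀ y : E, radialBump y • fderiv ℝ g (x + (r * S) • y) (S • y) =
        S • (radialBump y • fderiv ℝ g (x + (r * S) • y) y) := fun y => by
      rw [map_smul, smul_comm]
    simp_rw [hS]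
    rw [integral_smul, integral_radialBump_smul_fderiv_eq_zero hg, smul_zero]
    refine fun z hz => hΔ z (closedBall_subset_closedBall ?_ hz)
    rw [abs_mul, abs_of_nonneg hr.1]
    exact mul_le_of_le_one_left (abs_nonneg S) hr.2
  have hconst := constant_of_has_deriv_right_zero
    (f := fun r : ℝ => ∫ y : E, radialBump y • g (x + (r * S) • y)) (a := 0) (b := 1)
    (fun r _ => (hder r).continuousAt.continuousWithinAt)
    (fun r hr => by
      rw [← hzero r ⟨hr.1, hr.2.le⟩]
      exact (hder r).hasDerivWithinAt) 1 (by simp)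
  rw [← integral_smul_const]
  simpa using hconst

/-- The mean value property of harmonic functions with respect to the radial bump. -/
theorem integral_radialBump_smul {f : E → ℂ} {x : E} {S : ℝ}
    (hf : HarmonicOnNhd f (closedBall x |S|)) :
    ∫ y : E, radialBump y • f (x + S • y) = (∫ y : E, radialBump y) • f x := by
  obtain ⟨δ, hδ, hsub⟩ := (isCompact_closedBall x |S|).exists_cthickening_subset_open
    (isOpen_setOfPred_harmonicAt f) hf
  have hU : ∀ z ∈ closedBall x (|S| + δ), HarmonicAt f z := by
    intro z hz
    apply hsub
    rw [cthickening_closedBall hδ.le (abs_nonneg S)]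
    rwa [add_comm]
  -- Cutting off makes the function globally C² with compact support, while leaving it unchanged on
  -- a neighbourhood of the closed ball, where its Laplacian matters.
  let χ : ContDiffBump x := ⟨|S| + δ / 2, |S| + δ, by positivity, by linarith⟩
  have hχ : ∀ z ∈ ball x (|S| + δ / 2), χ z • f z = f z := fun z hz => by
    rw [χ.one_of_mem_closedBall (ball_subset_closedBall hz), one_smul]
  have hsub' : closedBall x |S| ⊆ ball x (|S| + δ / 2) :=
    closedBall_subset_ball (by linarith)
  have key := integral_radialBump_smul_of_contDiff (g := fun z => χ z • f z) (x := x) (S := S)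
    ?_ ?_ ?_
  · rw [hχ x (mem_ball_self (by positivity))] at key
    rw [← key]
    congr 1
    ext1 y
    by_cases hy : 1 ≤ ‖y‖
    · simp [radialBump_eq_zero hy]
    · rw [hχ]
      apply hsub'
      rw [mem_closedBall, dist_self_add_left, norm_smul, Real.norm_eq_abs]
      exact mul_le_of_le_one_right (abs_nonneg S) (not_le.1 hy).le
  · refine contDiff_iff_contDiffAt.2 fun z => ?_
    by_cases hz : z ∈ closedBall x (|S| + δ)
    · exact χ.contDiffAt.smul (hU z hz).1
    · have : (fun z => χ z • f z) =ᶠ[𝓝 z] fun _ => 0 := by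
        filter_upwards [isClosed_closedBall.isOpen_compl.mem_nhds hz] with w hw
        rw [χ.zero_of_le_dist, zero_smul]
        rw [Set.mem_compl_iff, mem_closedBall, not_le] at hw
        exact hw.le
      exact contDiffAt_const.congr_of_eventuallyEq this
  · exact χ.hasCompactSupport.smul_right
  · intro z hz
    have : (fun z => χ z • f z) =ᶠ[𝓝 z] f := by
      filter_upwards [isOpen_ball.mem_nhds (hsub' hz)] with w hw using hχ w hw
    rw [(laplacian_congr_nhds this).eq_of_nhds]
    exact (hf z hz).2.eq_of_nhds

end MeanValue

end HarmFilt

namespace HarmFilt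

open Metric Filter Topology

/-! ### Second differences of C² functions and of their products. -/

section SecondDifferences

variable {E : Type*} [NormedAddCommGroup E] [NormedSpace ℝ E]

lemma exists_difference_bounds {φ : E → ℝ} (hφ : ContDiff ℝ 2 φ) (hs : HasCompactSupport φ) :
    ∃ A : ℝ, 0 ≤ A ∧ (∀ z, |φ z| ≤ A) ∧ (∀ z v, |φ (z + v) - φ z| ≤ A * ‖v‖) ∧
      ∀ z v, |φ (z + v) + φ (z - v) - 2 * φ z| ≤ A * ‖v‖ ^ 2 := by
  obtain ⟨A₀, hA₀⟩ := hs.exists_bound_of_continuous hφ.continuous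
  obtain ⟨A₁, hA₁⟩ := hφ.lipschitzWith_of_hasCompactSupport hs two_ne_zero
  have hφ' : ContDiff ℝ 1 (fderiv ℝ φ) := hφ.fderiv_right (by norm_num)
  obtain ⟨A₂, hA₂⟩ := hφ'.lipschitzWith_of_hasCompactSupport (hs.fderiv ℝ) one_ne_zero
  have hA₀0 : 0 ≤ A₀ := (norm_nonneg _).trans (hA₀ 0)
  refine ⟨A₀ + A₁ + 2 * A₂, by positivity, fun z => ?_, fun z v => ?_, fun z v => ?_⟩
  · exact (hA₀ z).trans (by linarith [A₁.2, A₂.2])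
  · have := hA₁.dist_le_mul (z + v) z
    rw [Real.dist_eq, dist_self_add_left] at this
    exact this.trans (by gcongr; linarith [A₂.2])
  · have hd : ∀ t : ℝ, HasDerivAt (fun t : ℝ => φ (z + t • v) + φ (z - t • v))
        (fderiv ℝ φ (z + t • v) v - fderiv ℝ φ (z - t • v) v) t := by
      intro t
      have h0 : HasDerivAt (fun t : ℝ => t • v) v t := by
        simpa using (hasDerivAt_id t).smul_const v
      have h1 := (hφ.differentiable two_ne_zero (z + t • v)).hasFDerivAt.comp_hasDerivAt t
        (h0.const_add z)
      have h2 := (hφ.differentiable two_ne_zero (z - t • v)).hasFDerivAt.comp_hasDerivAt t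
        (h0.const_sub z)
      refine (h1.add h2).congr_deriv ?_
      rw [map_neg, ← sub_eq_add_neg]
    have hb := norm_image_sub_le_of_norm_deriv_le_segment_01' (C := 2 * A₂ * ‖v‖ ^ 2)
      (fun t _ => (hd t).hasDerivWithinAt) (fun t ht => ?_)
    · simp only [one_smul, zero_smul, add_zero, sub_zero, Real.norm_eq_abs] at hb
      rw [two_mul]
      exact hb.trans (by gcongr; linarith [A₁.2])
    · rw [← sub_apply]
      refine (ContinuousLinearMap.le_opNorm _ _).trans ?_
      have h1 := hA₂.dist_le_mul (z + t • v) (z - t • v)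
      rw [dist_eq_norm, dist_eq_norm, add_sub_sub_cancel, ← two_smul ℝ (t • v), norm_smul,
        norm_smul, Real.norm_eq_abs, Real.norm_eq_abs, abs_of_nonneg ht.1] at h1
      have h3 : (A₂ : ℝ) * (|2| * (t * ‖v‖)) ≤ A₂ * (2 * (1 * ‖v‖)) := by
        rw [abs_two]
        gcongr
        exact ht.2.le
      calc _ ≤ A₂ * (2 * (1 * ‖v‖)) * ‖v‖ := by
            gcongr
            exact h1.trans h3
        _ = _ := by ring

/-- A discrete Leibniz rule: with `u = w - z`, the second difference is the sum of two terms (value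
times second difference) and two products of first differences, the four quantities `p1`–`p4`. The
bound is uniform in `w`, as the quadrature of a convolution requires. -/
lemma exists_second_difference_bound_mul {φ : E → ℝ} (hφ : ContDiff ℝ 2 φ)
    (hs : HasCompactSupport φ) : ∃ A : ℝ, 0 ≤ A ∧ ∀ w z v,
      |φ (z + v) * φ (w - (z + v)) + φ (z - v) * φ (w - (z - v)) - 2 * (φ z * φ (w - z))|
        ≤ A * ‖v‖ ^ 2 := by
  obtain ⟨A, hA, h0, h1, h2⟩ := exists_difference_bounds hφ hs
  refine ⟨4 * A ^ 2, by positivity, fun w z v => ?_⟩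
  have e1 : w - (z + v) = (w - z) - v := by abel
  have e2 : w - (z - v) = (w - z) + v := by abel
  rw [e1, e2]
  set u := w - z
  have p1 : |φ u * (φ (z + v) + φ (z - v) - 2 * φ z)| ≤ A * (A * ‖v‖ ^ 2) := by
    rw [abs_mul]
    exact mul_le_mul (h0 _) (h2 _ _) (abs_nonneg _) hA
  have p2 : |φ z * (φ (u + v) + φ (u - v) - 2 * φ u)| ≤ A * (A * ‖v‖ ^ 2) := by
    rw [abs_mul]
    exact mul_le_mul (h0 _) (h2 _ _) (abs_nonneg _) hA
  have m : ∀ a, |φ (a - v) - φ a| ≤ A * ‖v‖ := fun a => by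
    simpa [sub_eq_add_neg] using h1 a (-v)
  have p3 : |(φ (z + v) - φ z) * (φ (u - v) - φ u)| ≤ A * ‖v‖ * (A * ‖v‖) := by
    rw [abs_mul]
    exact mul_le_mul (h1 _ _) (m _) (abs_nonneg _) (by positivity)
  have p4 : |(φ (z - v) - φ z) * (φ (u + v) - φ u)| ≤ A * ‖v‖ * (A * ‖v‖) := by
    rw [abs_mul]
    exact mul_le_mul (m _) (h1 _ _) (abs_nonneg _) (by positivity)
  rw [abs_le] at *
  constructor <;> linarith [p1.1, p1.2, p2.1, p2.2, p3.1, p3.2, p4.1, p4.2]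

end SecondDifferences

/-! ### Midpoint rule on a cubic lattice. -/

section Quadrature

variable {d : ℕ}

/-- The half-open cube of side `h` centred at `h n`. -/
def latticeCube (h : ℝ) (n : Lattice d) : Set (Fin d → ℝ) :=
  Set.univ.pi fun i => Set.Ico (h * n i - h / 2) (h * n i + h / 2)

lemma measurableSet_latticeCube (h : ℝ) (n : Lattice d) : MeasurableSet (latticeCube h n) :=
  MeasurableSet.univ_pi fun _ => measurableSet_Ico

lemma mem_latticeCube_iff {h : ℝ} (hh : 0 < h) {n : Lattice d} {z : Fin d → ℝ} :
    z ∈ latticeCube h n ↔ n = fun i => ⌊z i / h + 1 / 2⌋ := by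
  simp only [latticeCube, Set.mem_univ_pi, Set.mem_Ico, funext_iff]
  refine forall_congr' fun i => ?_
  rw [eq_comm, Int.floor_eq_iff, ← sub_le_iff_le_add, le_div_iff₀ hh,
    show z i / h + 1 / 2 < n i + 1 ↔ z i / h < n i + 1 / 2 by constructor <;> intro <;> linarith,
    div_lt_iff₀ hh]
  constructor <;> rintro ⟨h1, h2⟩ <;> constructor <;> linarith

lemma setIntegral_latticeCube (h : ℝ) (n : Lattice d) (K : (Fin d → ℝ) → ℝ) :
    ∫ z in latticeCube h n, K z =
      ∫ v in Set.Icc (fun _ : Fin d => -(h / 2)) (fun _ => h / 2), K ((fun i => h * n i) + v) := by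
  have h1 : latticeCube h n =ᵐ[volume]
      Set.Icc (fun i => h * n i - h / 2) (fun i => h * n i + h / 2) :=
    Measure.univ_pi_Ico_ae_eq_Icc
  rw [setIntegral_congr_set h1,
    ← (measurePreserving_add_left volume (fun i => h * (n i : ℝ))).setIntegral_preimage_emb
      (measurableEmbedding_addLeft _)]
  congr 2
  ext v
  simp only [Set.mem_preimage, Set.mem_Icc, Pi.le_def, Pi.add_apply]
  refine and_congr (forall_congr' fun i => ?_) (forall_congr' fun i => ?_) <;>
    constructor <;> intro <;> linarith

/-- The cube is symmetric about its centre, so averaging the integral with its reflection cancels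
first order terms and leaves half the integral of a second difference. -/
lemma abs_setIntegral_latticeCube_sub_le {h : ℝ} (hh : 0 < h) {K : (Fin d → ℝ) → ℝ}
    (hK : Continuous K) {B : ℝ}
    (hB : ∀ z v : Fin d → ℝ, (∀ i, |v i| ≤ h / 2) → |K (z + v) + K (z - v) - 2 * K z| ≤ B)
    (n : Lattice d) :
    |(∫ z in latticeCube h n, K z) - h ^ d * K (fun i => h * n i)| ≤ B * h ^ d := by
  set Q : Set (Fin d → ℝ) := Set.Icc (fun _ : Fin d => -(h / 2)) (fun _ => h / 2) with hQ
  set p : Fin d → ℝ := fun i => h * n i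
  have hvol : volume.real Q = h ^ d := by
    rw [hQ, measureReal_def, Real.volume_Icc_pi_toReal (fun _ => by linarith)]
    simp
  have hfin : volume Q < ⊤ := measure_Icc_lt_top
  have hQc : IsCompact Q := isCompact_Icc
  have hneg : ∫ v in Q, K (p + v) = ∫ v in Q, K (p - v) := by
    rw [← (Measure.measurePreserving_neg (volume : Measure (Fin d → ℝ))).setIntegral_preimage_emb
      (Homeomorph.neg (Fin d → ℝ)).measurableEmbedding]
    simp_rw [sub_eq_add_neg]
    congr 2
    ext v
    simp only [hQ, Set.mem_preimage, Set.mem_Icc, Pi.le_def, Pi.neg_apply]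
    constructor <;> rintro ⟨h1, h2⟩ <;> constructor <;> intro i <;>
      linarith [h1 i, h2 i]
  have hi1 : IntegrableOn (fun v => K (p + v)) Q :=
    (by fun_prop : Continuous fun v => K (p + v)).continuousOn.integrableOn_compact hQc
  have hi2 : IntegrableOn (fun v => K (p - v)) Q :=
    (by fun_prop : Continuous fun v => K (p - v)).continuousOn.integrableOn_compact hQc
  have hi3 : IntegrableOn (fun _ => 2 * K p) Q :=
    continuous_const.continuousOn.integrableOn_compact hQc
  have hsplit : ∫ v in Q, (K (p + v) + K (p - v) - 2 * K p) =
      2 * ((∫ v in Q, K (p + v)) - h ^ d * K p) := by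
    rw [integral_sub (by exact hi1.add hi2) hi3, integral_add hi1 hi2, ← hneg, setIntegral_const, hvol,
      smul_eq_mul]
    ring
  have hle := norm_setIntegral_le_of_norm_le_const (C := B) hfin
    (f := fun v => K (p + v) + K (p - v) - 2 * K p) fun v hv => hB p v fun i => by
      rw [abs_le]
      exact ⟨hv.1 i, hv.2 i⟩
  rw [hsplit, hvol, Real.norm_eq_abs, abs_mul, abs_two] at hle
  rw [setIntegral_latticeCube]
  linarith [abs_nonneg ((∫ v in Q, K (p + v)) - h ^ d * K p)]

/-- The lattice points with all coordinates in `[-N, N]`. -/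
noncomputable def latticeBox (d N : ℕ) : Finset (Lattice d) :=
  Fintype.piFinset fun _ => Finset.Icc (-(N : ℤ)) N

lemma card_latticeBox (d N : ℕ) : (latticeBox d N).card = (2 * N + 1) ^ d := by
  rw [latticeBox, Fintype.card_piFinset_const, Int.card_Icc]
  congr 1
  omega

lemma mem_latticeBox {N : ℕ} {n : Lattice d} : n ∈ latticeBox d N ↔ ∀ i, |n i| ≤ N := by
  simp [latticeBox, abs_le]

/-- Second order accuracy of lattice sums as approximations of integrals. -/
lemma abs_integral_sub_lattice_sum_le {h : ℝ} (hh : 0 < h) {K : (Fin d → ℝ) → ℝ}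
    (hK : Continuous K) {B : ℝ}
    (hB : ∀ z v : Fin d → ℝ, (∀ i, |v i| ≤ h / 2) → |K (z + v) + K (z - v) - 2 * K z| ≤ B)
    {N : ℕ} (hN : 1 + h / 2 ≤ h * (N + 1)) (hsupp : ∀ z, (∃ i, 1 ≤ |z i|) → K z = 0) :
    |(∫ z, K z) - ∑ n ∈ latticeBox d N, h ^ d * K (fun i => h * n i)| ≤
      B * h ^ d * (2 * N + 1) ^ d := by
  have hcs : HasCompactSupport K := by
    refine HasCompactSupport.intro (isCompact_closedBall (0 : Fin d → ℝ) 1) fun z hz => hsupp z ?_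
    by_contra! hcon
    exact hz (mem_closedBall_zero_iff.2 ((pi_norm_le_iff_of_nonneg zero_le_one).2
      fun i => (hcon i).le))
  have hint : Integrable K := hK.integrable_of_hasCompactSupport hcs
  have hcover : ∫ z, K z = ∑ n ∈ latticeBox d N, ∫ z in latticeCube h n, K z := by
    rw [← integral_biUnion_finset _ (fun n _ => measurableSet_latticeCube h n) ?_
      (fun n _ => hint.integrableOn)]
    · refine (setIntegral_eq_integral_of_forall_compl_eq_zero fun z hz => ?_).symm
      by_contra hKz
      have hz1 : ∀ i, |z i| < 1 := fun i => by
        by_contra! hi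
        exact hKz (hsupp z ⟨i, hi⟩)
      apply hz
      refine Set.mem_iUnion₂.2 ⟨fun i => ⌊z i / h + 1 / 2⌋, mem_latticeBox.2 fun i => ?_,
        (mem_latticeCube_iff hh).2 rfl⟩
      obtain ⟨hl, hr⟩ := abs_lt.1 (hz1 i)
      have h1 : z i / h < N + 1 / 2 := by
        rw [div_lt_iff₀ hh]
        linarith
      have h2 : -(N + 1 / 2 : ℝ) < z i / h := by
        rw [lt_div_iff₀ hh]
        linarith
      rw [abs_le]
      constructor
      · rw [Int.le_floor]
        push_cast
        linarith
      · rw [← Int.lt_add_one_iff, Int.floor_lt]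
        push_cast
        linarith
    · intro m _ n _ hmn
      refine Set.disjoint_left.2 fun z hm hn => hmn ?_
      rw [mem_latticeCube_iff hh] at hm hn
      rw [hm, hn]
  rw [hcover, ← Finset.sum_sub_distrib]
  refine (Finset.abs_sum_le_sum_abs _ _).trans ?_
  refine (Finset.sum_le_card_nsmul _ _ _ fun n _ =>
    abs_setIntegral_latticeCube_sub_le hh hK hB n).trans (le_of_eq ?_)
  rw [card_latticeBox, nsmul_eq_mul]
  push_cast
  ring

end Quadrature

end HarmFilt

namespace HarmFilt

open Metric Filter Topology InnerProductSpace

/-! ### The normalized kernel and its self-convolution. -/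

section MeanKernel

variable {E : Type*} [NormedAddCommGroup E] [InnerProductSpace ℝ E] [FiniteDimensional ℝ E]
  [MeasurableSpace E] [BorelSpace E]

/-- The radial bump, normalized to have integral one. -/
noncomputable def meanKernel (y : E) : ℝ := (∫ u : E, radialBump u)⁻¹ * radialBump y

lemma contDiff_meanKernel : ContDiff ℝ 2 (meanKernel : E → ℝ) :=
  contDiff_const.mul contDiff_radialBump

lemma meanKernel_eq_zero {y : E} (hy : 1 ≤ ‖y‖) : meanKernel y = 0 := by
  rw [meanKernel, radialBump_eq_zero hy, mul_zero]

lemma hasCompactSupport_meanKernel : HasCompactSupport (meanKernel : E → ℝ) :=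
  hasCompactSupport_of_eq_zero 1 fun _ hy => meanKernel_eq_zero hy

theorem integral_meanKernel_smul {f : E → ℂ} {x : E} {S : ℝ}
    (hf : HarmonicOnNhd f (closedBall x |S|)) :
    ∫ y : E, meanKernel y • f (x + S • y) = f x := by
  simp_rw [meanKernel, mul_smul]
  rw [integral_smul, integral_radialBump_smul hf, inv_smul_smul₀ integral_radialBump_pos.ne']

/-- A harmonic function is reproduced by twice averaging against the mean kernel. -/
lemma integral_meanKernel_conv_smul {F : E → ℂ} (hFc : Continuous F)
    (hF : ∀ z : E, ‖z‖ ≤ 1 → ∫ w, meanKernel (w - z) • F w = F z) :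
    ∫ w, (∫ z : E, meanKernel z * meanKernel (w - z)) • F w = F 0 := by
  have hk : Continuous (meanKernel : E → ℝ) := contDiff_meanKernel.continuous
  have hint : Integrable (Function.uncurry fun z w : E =>
      (meanKernel z * meanKernel (w - z)) • F w) (volume.prod volume) := by
    refine Continuous.integrable_of_hasCompactSupport
      (by simp only [Function.uncurry_def]; fun_prop) ?_
    refine HasCompactSupport.intro
      ((isCompact_closedBall (0 : E) 1).prod (isCompact_closedBall (0 : E) 2)) ?_
    rintro ⟨z, w⟩ hzw
    by_cases hz : 1 ≤ ‖z‖
    · simp [meanKernel_eq_zero hz]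
    by_cases hw : 1 ≤ ‖w - z‖
    · simp [meanKernel_eq_zero hw]
    refine absurd ?_ hzw
    rw [Set.mem_prod, mem_closedBall_zero_iff, mem_closedBall_zero_iff]
    have := norm_le_norm_add_norm_sub' w z
    constructor <;> simp only <;> linarith
  simp_rw [← integral_smul_const]
  rw [← integral_integral_swap hint]
  have h0 := hF 0 (by simp)
  simp only [sub_zero] at h0
  rw [← h0]
  congr 1
  ext1 z
  by_cases hz : 1 ≤ ‖z‖
  · simp [meanKernel_eq_zero hz]
  · rw [← hF z (not_le.1 hz).le, ← integral_smul]
    simp_rw [mul_smul]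

end MeanKernel

/-! ### The filter, its norm, and its error on harmonic functions. -/

section MeanFilter

variable {d : ℕ}

/-- The mesh of the rescaled lattice used for the filter of order `T`. -/
noncomputable def mesh (T : ℕ) : ℝ := 2 / (T + 1)

lemma mesh_pos (T : ℕ) : 0 < mesh T := by
  unfold mesh
  positivity

lemma mesh_mul_le (T : ℕ) : mesh T * (2 * T + 1) ≤ 4 := by
  rw [mesh, div_mul_eq_mul_div, div_le_iff₀ (by positivity)]
  linarith

lemma mesh_pow_mul_le (d T : ℕ) : mesh T ^ d * (2 * T + 1) ^ d ≤ 4 ^ d := by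
  rw [← mul_pow]
  have := mesh_pos T
  exact pow_le_pow_left₀ (by positivity) (mesh_mul_le T) d

/-- The discretization of the mean kernel, a filter of order at most `T`. -/
noncomputable def meanFilter (d T : ℕ) : LatticeFilter d :=
  Finsupp.indicator (latticeBox d T) fun n _ =>
    ((mesh T ^ d * meanKernel (mesh T • latticePoint n) : ℝ) : ℂ)

lemma latticeNorm_le_iff {n : Lattice d} {N : ℕ} : latticeNorm n ≤ N ↔ ∀ i, |n i| ≤ N := by
  simp only [latticeNorm, Finset.sup_le_iff, Finset.mem_univ, true_imp_iff]
  refine forall_congr' fun i => ?_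
  rw [Int.abs_eq_natAbs]
  exact Nat.cast_le.symm

lemma orderLE_meanFilter (d T : ℕ) : OrderLE (meanFilter d T) T := by
  intro n hn
  refine Finsupp.indicator_of_notMem (fun hmem => ?_) _
  exact hn.not_ge (latticeNorm_le_iff.2 (mem_latticeBox.1 hmem))

lemma applyFilter_meanFilter (T : ℕ) (s : Lattice d → ℂ) (τ : Lattice d) :
    applyFilter (meanFilter d T) s τ = ∑ n ∈ latticeBox d T,
      (mesh T ^ d * meanKernel (mesh T • latticePoint n)) • s (τ - n) := by
  rw [applyFilter, meanFilter, Finsupp.sum_indicator_index _ (by simp)]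
  exact Finset.sum_congr rfl fun n _ => Complex.real_smul.symm

lemma exists_l2norm_meanFilter_le (d : ℕ) : ∃ C : ℝ, ∀ T : ℕ,
    l2norm (meanFilter d T) ≤ C / (2 * (T : ℝ) + 1) ^ ((d : ℝ) / 2) := by
  obtain ⟨A, hA⟩ := (hasCompactSupport_meanKernel
    (E := EuclideanSpace ℝ (Fin d))).exists_bound_of_continuous contDiff_meanKernel.continuous
  have hA0 : 0 ≤ A := (norm_nonneg _).trans (hA 0)
  refine ⟨4 ^ d * A, fun T => ?_⟩
  have hh := mesh_pos T
  have hsum : (meanFilter d T).sum (fun _ a => ‖a‖ ^ 2) ≤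
      (2 * T + 1) ^ d * (mesh T ^ d * A) ^ 2 := by
    rw [meanFilter, Finsupp.sum_indicator_index _ (by simp)]
    refine (Finset.sum_le_card_nsmul _ _ ((mesh T ^ d * A) ^ 2) fun n _ => ?_).trans
      (le_of_eq ?_)
    · rw [Complex.norm_real, norm_mul, Real.norm_of_nonneg (pow_pos hh d).le]
      gcongr
      exact hA _
    · rw [card_latticeBox, nsmul_eq_mul]
      push_cast
      rfl
  have hT : (0 : ℝ) < 2 * T + 1 := by positivity
  have hhalf : ((2 * (T : ℝ) + 1) ^ ((d : ℝ) / 2)) ^ 2 = (2 * T + 1) ^ d := by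
    rw [← Real.rpow_natCast, ← Real.rpow_mul hT.le, ← Real.rpow_natCast]
    congr 1
    push_cast
    ring
  rw [l2norm, le_div_iff₀ (by positivity)]
  refine le_of_sq_le_sq ?_ (by positivity)
  rw [mul_pow, hhalf, Real.sq_sqrt (Finsupp.sum_nonneg fun _ _ => by positivity)]
  calc _ ≤ (2 * T + 1) ^ d * (mesh T ^ d * A) ^ 2 * (2 * T + 1) ^ d := by gcongr
    _ = (mesh T ^ d * (2 * T + 1) ^ d) ^ 2 * A ^ 2 := by ring
    _ ≤ (4 ^ d) ^ 2 * A ^ 2 := by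
        gcongr
        exact mesh_pow_mul_le d T
    _ = _ := by ring

lemma exists_meanKernel_quadrature_bound (d : ℕ) : ∃ C : ℝ, 0 ≤ C ∧
    ∀ (T : ℕ) (w : EuclideanSpace ℝ (Fin d)),
      |(∫ z, meanKernel z * meanKernel (w - z)) - ∑ n ∈ latticeBox d T,
        mesh T ^ d * (meanKernel (mesh T • latticePoint n) *
          meanKernel (w - mesh T • latticePoint n))| ≤ C * mesh T ^ 2 := by
  obtain ⟨A, hA, hA2⟩ := exists_second_difference_bound_mul
    (contDiff_meanKernel (E := EuclideanSpace ℝ (Fin d))) hasCompactSupport_meanKernel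
  refine ⟨A * d * 4 ^ d, by positivity, fun T w => ?_⟩
  have hh := mesh_pos T
  have hk : Continuous (meanKernel : EuclideanSpace ℝ (Fin d) → ℝ) :=
    contDiff_meanKernel.continuous
  have hp : ∀ n : Lattice d, WithLp.toLp 2 (fun i => mesh T * (n i : ℝ)) =
      mesh T • latticePoint n := fun n => by
    ext i
    simp [latticePoint]
  have key := abs_integral_sub_lattice_sum_le (d := d) hh (N := T) (B := A * (d * mesh T ^ 2))
    (K := fun z => meanKernel (WithLp.toLp 2 z) * meanKernel (w - WithLp.toLp 2 z))
    (by fun_prop) ?_ ?_ ?_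
  · rw [← (PiLp.volume_preserving_toLp (Fin d)).integral_comp
      (MeasurableEquiv.toLp 2 (Fin d → ℝ)).measurableEmbedding]
    simp_rw [hp] at key
    refine key.trans ?_
    calc _ = A * d * mesh T ^ 2 * (mesh T ^ d * (2 * T + 1) ^ d) := by ring
      _ ≤ A * d * mesh T ^ 2 * 4 ^ d := by
          gcongr
          exact mesh_pow_mul_le d T
      _ = _ := by ring
  · intro z v hv
    refine (hA2 w (WithLp.toLp 2 z) (WithLp.toLp 2 v)).trans ?_
    gcongr
    rw [EuclideanSpace.norm_sq_eq]
    refine (Finset.sum_le_card_nsmul _ _ (mesh T ^ 2) fun i _ => ?_).trans (le_of_eq ?_)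
    · rw [Real.norm_eq_abs]
      have := hv i
      gcongr
      simp only
      linarith
    · simp
  -- The cubes with `|n| ≤ T` cover the kernel's support because `1 + h/2 ≤ 2`, with equality at `T
  -- = 0`, where `h = 2`.
  · rw [show mesh T * (T + 1) = 2 by unfold mesh; field_simp]
    have : mesh T ≤ 2 := by
      unfold mesh
      exact div_le_self zero_le_two (by linarith [(T.cast_nonneg : (0 : ℝ) ≤ T)])
    linarith
  · rintro z ⟨i, hi⟩
    rw [meanKernel_eq_zero (y := WithLp.toLp 2 z), zero_mul]
    exact hi.trans (PiLp.norm_apply_le (p := 2) (WithLp.toLp 2 z) i)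

/-- The mean filter almost reproduces harmonic functions. -/
theorem exists_norm_sub_meanFilter_le (d : ℕ) : ∃ C : ℝ, 0 ≤ C ∧
    ∀ (T : ℕ) (f : EuclideanSpace ℝ (Fin d) → ℂ) (x : EuclideanSpace ℝ (Fin d)) (N : ℝ),
      Continuous f → HarmonicOnNhd f (closedBall x (T + 1)) →
      (∀ z ∈ closedBall x (T + 1), ‖f z‖ ≤ N) →
      ‖f x - ∑ n ∈ latticeBox d T,
        (mesh T ^ d * meanKernel (mesh T • latticePoint n)) • f (x - latticePoint n)‖ ≤
        C * mesh T ^ 2 * N := by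
  obtain ⟨C, hC, hquad⟩ := exists_meanKernel_quadrature_bound d
  refine ⟨C * volume.real (closedBall (0 : EuclideanSpace ℝ (Fin d)) 2), by positivity,
    fun T f x N hf hharm hN => ?_⟩
  have hh := mesh_pos T
  have hk : Continuous (meanKernel : EuclideanSpace ℝ (Fin d) → ℝ) :=
    contDiff_meanKernel.continuous
  have hks : HasCompactSupport (meanKernel : EuclideanSpace ℝ (Fin d) → ℝ) :=
    hasCompactSupport_meanKernel
  -- The sign makes the sample point `h n` correspond to `x - n`, as in the definition of a filter's
  -- output. The radius 2 of the support of `k*k` becomes `2|S| = T + 1`.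
  obtain ⟨S, hS⟩ : ∃ S : ℝ, S = -(mesh T)⁻¹ := ⟨_, rfl⟩
  have hSabs : |S| * 2 = T + 1 := by
    rw [hS, abs_neg, abs_of_pos (inv_pos.2 hh), mesh]
    field_simp
  have hSmesh : S * mesh T = -1 := by
    rw [hS, neg_mul, inv_mul_cancel₀ hh.ne']
  set F : EuclideanSpace ℝ (Fin d) → ℂ := fun w => f (x + S • w) with hF
  have hFc : Continuous F := by fun_prop
  have hmean : ∀ z, ‖z‖ ≤ 1 → ∫ w, meanKernel (w - z) • F w = F z := by
    intro z hz
    have hsub : closedBall (x + S • z) |S| ⊆ closedBall x (T + 1) := by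
      refine closedBall_subset_closedBall' ?_
      rw [dist_self_add_left, norm_smul, Real.norm_eq_abs, ← hSabs, mul_two]
      gcongr
      exact mul_le_of_le_one_right (abs_nonneg S) hz
    have h1 := integral_meanKernel_smul (hharm.mono hsub)
    have h2 := integral_sub_right_eq_self (μ := volume)
      (fun w => meanKernel w • F (w + z)) z
    simp only [sub_add_cancel] at h2
    rw [h2, show F z = f (x + S • z) from rfl, ← h1]
    congr 1
    ext1 y
    rw [hF]
    simp only [smul_add]
    congr 2
    abel
  have hint : ∀ z, Integrable fun w => meanKernel (w - z) • F w := fun z => by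
    refine Continuous.integrable_of_hasCompactSupport (by fun_prop) ?_
    refine hasCompactSupport_of_eq_zero (1 + ‖z‖) fun w hw => ?_
    rw [meanKernel_eq_zero, zero_smul]
    linarith [norm_le_norm_add_norm_sub' w z]
  have hconv := integral_meanKernel_conv_smul hFc hmean
  have hF0 : F 0 = f x := by simp [hF]
  -- Each sample `F(hn)` with nonzero weight has `‖hn‖ < 1`, so the mean value property replaces it
  -- by an average of `F`.
  have hsum : ∑ n ∈ latticeBox d T,
      (mesh T ^ d * meanKernel (mesh T • latticePoint n)) • f (x - latticePoint n) =
      ∫ w, (∑ n ∈ latticeBox d T, mesh T ^ d * (meanKernel (mesh T • latticePoint n) *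
          meanKernel (w - mesh T • latticePoint n))) • F w := by
    simp_rw [Finset.sum_smul]
    rw [integral_finsetSum]
    · refine Finset.sum_congr rfl fun n _ => ?_
      simp_rw [← mul_assoc, mul_smul _ (meanKernel (_ - _))]
      rw [integral_smul]
      by_cases hn : 1 ≤ ‖mesh T • (latticePoint n : EuclideanSpace ℝ (Fin d))‖
      · simp [meanKernel_eq_zero hn]
      · rw [hmean _ (not_le.1 hn).le, hF]
        simp only [smul_smul, hSmesh, neg_smul, one_smul, sub_eq_add_neg]
    · intro n _
      simp_rw [← mul_assoc, mul_smul _ (meanKernel (_ - _))]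
      exact (hint _).smul _
  have hvan : ∀ w z : EuclideanSpace ℝ (Fin d), 2 ≤ ‖w‖ →
      meanKernel z * meanKernel (w - z) = 0 := by
    intro w z hw
    by_cases hz : 1 ≤ ‖z‖
    · rw [meanKernel_eq_zero hz, zero_mul]
    · rw [meanKernel_eq_zero (y := w - z), mul_zero]
      linarith [norm_le_norm_add_norm_sub' w z]
  set I : EuclideanSpace ℝ (Fin d) → ℝ := fun w => ∫ z, meanKernel z * meanKernel (w - z)
  set J : EuclideanSpace ℝ (Fin d) → ℝ := fun w => ∑ n ∈ latticeBox d T,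
    mesh T ^ d * (meanKernel (mesh T • latticePoint n) *
      meanKernel (w - mesh T • latticePoint n))
  have hI0 : ∀ w, 2 ≤ ‖w‖ → I w = 0 := fun w hw => by simp [I, hvan w _ hw]
  have hJ0 : ∀ w, 2 ≤ ‖w‖ → J w = 0 := fun w hw => by simp [J, hvan w _ hw]
  have hIc : Continuous I := by
    have h := hks.continuous_convolution_left (L := ContinuousLinearMap.mul ℝ ℝ) (μ := volume)
      hk (hk.locallyIntegrable)
    refine (h.congr fun w => ?_)
    rfl
  have hJc : Continuous J := by fun_prop
  have hIint : Integrable fun w => I w • F w :=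
    (hIc.smul hFc).integrable_of_hasCompactSupport
      (hasCompactSupport_of_eq_zero 2 fun w hw => by
        rw [Pi.smul_apply', hI0 w hw, zero_smul])
  have hJint : Integrable fun w => J w • F w :=
    (hJc.smul hFc).integrable_of_hasCompactSupport
      (hasCompactSupport_of_eq_zero 2 fun w hw => by
        rw [Pi.smul_apply', hJ0 w hw, zero_smul])
  rw [hsum, ← hF0, ← hconv, ← integral_sub hIint hJint]
  simp_rw [← sub_smul]
  rw [← setIntegral_eq_integral_of_forall_compl_eq_zero (s := closedBall 0 2)]
  · refine (norm_setIntegral_le_of_norm_le_const (C := C * mesh T ^ 2 * N)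
      measure_closedBall_lt_top fun w hw => ?_).trans (le_of_eq (by ring))
    rw [norm_smul]
    refine mul_le_mul (hquad T w) (hN _ ?_) (norm_nonneg _) (by positivity)
    rw [mem_closedBall_zero_iff] at hw
    rw [mem_closedBall, dist_self_add_left, norm_smul, Real.norm_eq_abs, ← hSabs]
    gcongr
  · intro w hw
    rw [mem_closedBall_zero_iff, not_le] at hw
    rw [hI0 w hw.le, hJ0 w hw.le, sub_zero, zero_smul]

end MeanFilter

end HarmFilt

/-! ### Passage to random fields and choice of constants. -/

namespace HarmFilt

open Metric Filter Topology InnerProductSpace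

variable {d : ℕ}

lemma closedBall_subset_interior_box {M : ℕ} {x : EuclideanSpace ℝ (Fin d)} {r : ℝ}
    (hx : ∀ i, |x i| + r < 2 * M) : closedBall x r ⊆ interior (box d M) := by
  have hopen : IsOpen {y : EuclideanSpace ℝ (Fin d) | ∀ i, |y i| < 2 * (M : ℝ)} := by
    rw [Set.ofPred_forall]
    exact isOpen_iInter_of_finite fun i => isOpen_lt (by fun_prop) continuous_const
  refine fun y hy => interior_maximal (fun y hy i => (hy i).le) hopen fun i => ?_
  rw [mem_closedBall, dist_eq_norm] at hy
  have h1 : |y i - x i| ≤ r := (PiLp.norm_apply_le (p := 2) (y - x) i).trans hy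
  have h2 := abs_add_le (x i) (y i - x i)
  rw [add_sub_cancel] at h2
  linarith [hx i]

lemma latticePoint_sub (m n : Lattice d) :
    latticePoint (m - n) = latticePoint m - latticePoint n := by
  ext i
  simp [latticePoint]

/-- This is where the dimension restriction acts: second order accuracy suffices when `d / 2 ≤ 2`.
-/
lemma mesh_sq_le {T : ℕ} (hd : d ≤ 4) :
    mesh T ^ 2 ≤ 16 * (2 * (T : ℝ) + 1) ^ (-((d : ℝ) / 2)) := by
  have hT : (1 : ℝ) ≤ 2 * T + 1 := by linarith [(T.cast_nonneg : (0 : ℝ) ≤ T)]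
  have hT0 : (0 : ℝ) < 2 * T + 1 := by linarith
  have h1 : (2 * (T : ℝ) + 1) ^ ((d : ℝ) / 2) ≤ (2 * T + 1) ^ 2 := by
    rw [← Real.rpow_natCast]
    refine Real.rpow_le_rpow_of_exponent_le hT ?_
    have : (d : ℝ) ≤ 4 := by exact_mod_cast hd
    push_cast
    linarith
  rw [Real.rpow_neg hT0.le, ← div_eq_mul_inv, le_div_iff₀ (by positivity)]
  have hh := mesh_pos T
  calc _ ≤ mesh T ^ 2 * (2 * T + 1) ^ 2 := by gcongr
    _ = (mesh T * (2 * T + 1)) ^ 2 := by ring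
    _ ≤ 4 ^ 2 := by
        gcongr
        exact mesh_mul_le T
    _ = 16 := by norm_num

lemma eLpNorm_two_le_of_enorm_le {Ω : Type*} [MeasurableSpace Ω] {P : Measure Ω} {g : Ω → ℂ}
    {b : Ω → ℝ≥0∞} {K R : ℝ} (hK : 0 ≤ K) (hR : 0 ≤ R)
    (hg : ∀ ω, ‖g ω‖ₑ ≤ ENNReal.ofReal K * b ω)
    (hb : ∫⁻ ω, b ω ^ 2 ∂P ≤ ENNReal.ofReal (R ^ 2)) :
    eLpNorm g 2 P ≤ ENNReal.ofReal (K * R) := by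
  rw [eLpNorm_eq_lintegral_rpow_enorm_toReal two_ne_zero ENNReal.ofNat_ne_top, one_div,
    ENNReal.rpow_inv_le_iff (by norm_num)]
  simp only [ENNReal.toReal_ofNat, ENNReal.rpow_ofNat]
  calc ∫⁻ ω, ‖g ω‖ₑ ^ 2 ∂P ≤ ∫⁻ ω, ENNReal.ofReal K ^ 2 * b ω ^ 2 ∂P := by
        refine lintegral_mono fun ω => ?_
        rw [← mul_pow]
        exact pow_le_pow_left₀ zero_le (hg ω) 2
    _ = ENNReal.ofReal K ^ 2 * ∫⁻ ω, b ω ^ 2 ∂P := lintegral_const_mul' _ _ (by simp)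
    _ ≤ ENNReal.ofReal K ^ 2 * ENNReal.ofReal (R ^ 2) := by gcongr
    _ = _ := by
        rw [ENNReal.ofReal_pow hR, ← mul_pow, ← ENNReal.ofReal_mul hK]

/-- In each dimension, the mean filters certify the well-filteredness of random harmonic
fields. -/
theorem exists_certifies_meanFilter (hd : d ≤ 4) : ∃ C₀ : ℝ, ∀ C : ℝ, C₀ ≤ C → 4 ≤ C →
    ∀ M : ℕ, 0 < M → ∀ R : ℝ, 0 < R →
    ∀ (Ω : Type*) [MeasurableSpace Ω] (P : Measure Ω),
    ∀ s ∈ randomHarmonicFields d M R P, ∀ (t : Lattice d) (L : ℕ),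
      (latticeNorm t : ℝ) ≤ C⁻¹ * M → (L : ℝ) ≤ C⁻¹ * M →
      ∀ T : ℕ, T ≤ L → Certifies P (meanFilter d T) s t L (C * R) C T := by
  obtain ⟨C₁, hC₁⟩ := exists_l2norm_meanFilter_le d
  obtain ⟨C₂, hC₂, hfilt⟩ := exists_norm_sub_meanFilter_le d
  refine ⟨max C₁ (C₂ * 16), ?_⟩
  intro C hC hC4 M hM R hR Ω _ P s hs t L ht hL T hTL
  obtain ⟨f, ⟨-, hharm, hbound⟩, rfl⟩ := hs
  have hT : (0 : ℝ) < 2 * T + 1 := by positivity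
  refine ⟨orderLE_meanFilter d T, (hC₁ T).trans ?_, fun τ hτ => ?_⟩
  · gcongr
    exact (le_max_left _ _).trans hC
  have hC2C : C₂ * 16 ≤ C := (le_max_right _ _).trans hC
  have hM1 : (1 : ℝ) ≤ M := by exact_mod_cast hM
  have hquarter : C⁻¹ * (M : ℝ) ≤ M / 4 := by
    rw [inv_mul_eq_div]
    gcongr
  have hTL' : (T : ℝ) ≤ L := by exact_mod_cast hTL
  have hsub : closedBall (latticePoint τ) ((T : ℝ) + 1) ⊆ interior (box d M) := by
    -- Since `C ≥ 4`, each of `|t|`, `L`, `T` is at most `M/4`. As `1 ≤ M`, the total `|t| + L + T +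
    -- 1` is at most `7M/4 < 2M`.
    refine closedBall_subset_interior_box fun i => ?_
    have h1 : |τ i - t i| ≤ (L : ℤ) := latticeNorm_le_iff.1 (by exact_mod_cast hτ) i
    have h2 : |t i| ≤ (latticeNorm t : ℤ) := latticeNorm_le_iff.1 le_rfl i
    have h1' : |(τ i : ℝ) - t i| ≤ L := by exact_mod_cast h1
    have h2' : |(t i : ℝ)| ≤ latticeNorm t := by exact_mod_cast h2
    have h3 := abs_add_le (t i : ℝ) ((τ i : ℝ) - t i)
    rw [add_sub_cancel] at h3
    change |(τ i : ℝ)| + (T + 1) < 2 * M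
    linarith
  set K : ℝ := C * (2 * (T : ℝ) + 1) ^ (-((d : ℝ) / 2)) with hKdef
  have hK : 0 < K := by positivity
  have hconst : C₂ * mesh T ^ 2 ≤ K := by
    calc C₂ * mesh T ^ 2 ≤ C₂ * (16 * (2 * (T : ℝ) + 1) ^ (-((d : ℝ) / 2))) := by
          gcongr
          exact mesh_sq_le hd
      _ = C₂ * 16 * (2 * (T : ℝ) + 1) ^ (-((d : ℝ) / 2)) := by ring
      _ ≤ K := by
          rw [hKdef]
          gcongr
  rw [show C * R * (2 * (T : ℝ) + 1) ^ (-((d : ℝ) / 2)) = K * R by rw [hKdef]; ring]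
  refine eLpNorm_two_le_of_enorm_le hK.le hR.le (b := fun ω => boxNorm M (f ω))
    (fun ω => ?_) hbound
  rcases eq_or_ne (boxNorm M (f ω)) ⊤ with htop | htop
  · simp [htop, hK]
  have hle : ∀ z ∈ closedBall (latticePoint τ) ((T : ℝ) + 1),
      ‖f ω z‖ ≤ (boxNorm M (f ω)).toReal := by
    intro z hz
    rw [← toReal_enorm]
    exact ENNReal.toReal_mono htop
      (le_iSup₂ (f := fun x (_ : x ∈ box d M) => ‖f ω x‖ₑ) z (interior_subset (hsub hz)))
  have key := hfilt T (f ω) (latticePoint τ) _ (hharm ω).1 ((hharm ω).2.mono hsub) hle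
  rw [applyFilter_meanFilter]
  simp_rw [latticePoint_sub]
  rw [← ENNReal.ofReal_toReal htop, ← ENNReal.ofReal_mul hK.le, ← ofReal_norm]
  refine ENNReal.ofReal_le_ofReal (key.trans ?_)
  gcongr

end HarmFilt

theorem mainTheorem6 :
    ∃ c : ℝ, 0 < c ∧ c ≤ 1 ∧
    ∃ q : (d : ℕ) → ℕ → HarmFilt.LatticeFilter d,
    ∀ d : ℕ, d ≤ 4 → ∀ M : ℕ, 0 < M → ∀ R : ℝ, 0 < R →
    ∀ (Ω : Type*) [MeasurableSpace Ω] (P : MeasureTheory.Measure Ω)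
      [MeasureTheory.IsProbabilityMeasure P],
    ∀ s ∈ HarmFilt.randomHarmonicFields d M R P,
    ∀ (t : HarmFilt.Lattice d) (L : ℕ),
      (HarmFilt.latticeNorm t : ℝ) ≤ c * M → (L : ℝ) ≤ c * M →
      HarmFilt.WellFiltered P s t L (c⁻¹ * R) c⁻¹ ∧
      ∀ T : ℕ, T ≤ L → HarmFilt.Certifies P (q d T) s t L (c⁻¹ * R) c⁻¹ T := by
  choose! C₀ hC₀ using fun (d : ℕ) (hd : d ≤ 4) => HarmFilt.exists_certifies_meanFilter hd
  -- Only the dimensions 0 to 4 occur, so one constant serves them all.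
  obtain ⟨B, hB⟩ := ((Finset.range 5).image C₀).bddAbove
  set C : ℝ := max B 4
  have hC4 : 4 ≤ C := le_max_right _ _
  refine ⟨C⁻¹, by positivity, inv_le_one_of_one_le₀ (by linarith), HarmFilt.meanFilter, ?_⟩
  intro d hd M hM R hR Ω _ P _ s hs t L ht hL
  rw [inv_inv]
  have hmem : C₀ d ∈ (Finset.range 5).image C₀ :=
    Finset.mem_image_of_mem _ (Finset.mem_range.2 (by omega))
  have hcert := hC₀ d hd C ((hB hmem).trans (le_max_left _ _)) hC4 M hM R hR Ω P s hs t L ht hL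
  exact ⟨fun T hT => ⟨HarmFilt.meanFilter d T, hcert T (by exact_mod_cast hT)⟩, hcert⟩
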